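/- A representation of a set $X$ is a surjective partial map $\delta_X:\subseteq\mathbb N^{\mathbb N}\to X$; if $\delta_X(p)=x$, then $p$ is called a name of $x$. Let $\langle p,q\rangle(2n)=p(n)$ and $\langle p,q\rangle(2n+1)=q(n)$; the product $X\times Y$ of represented spaces is represented by $\langle p,q\rangle\mapsto(\delta_X(p),\delta_Y(q))$. A partial function $F:\subseteq\mathbb N^{\mathbb N}\to\mathbb N^{\mathbb N}$ realizes a multi-valued partial function $f:\subseteq X\rightrightarrows Y$ on represented spaces (written $F\vdash f$) if, for every name $p$ of a point $x\in\mathrm{dom}(f)$, the value $F(p)$ is defined and is a name of a point of $f(x)$. One says that $f$ is Weihrauch reducible to $g$, $f\le_W g$, if there are computable partial functions $K,H:\subseteq\mathbb N^{\mathbb N}\to\mathbb N^{\mathbb N}$ (in the sense of type-2 computability) such that $p\mapsto K\langle p,G(H(p))\rangle$ realizes $f$ for every realizer $G$ of $g$. Write $f<_W g$ if $f\le_W g$ and $g\not\le_W f$, and $f\equiv_W g$ if $f\le_W g$ and $g\le_W f$. The product of $f$ and $g$ is $(f\times g)(x,z)=f(x)\times g(z)$, and $f$ is called idempotent if $f\equiv_W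 f\times f$. Let $[0,1]^n$ carry the maximum metric and the Cauchy representation with respect to a standard enumeration of its rational points (a name of $x$ enumerates a sequence of rational points $(a_i)_i$ with limit $x$ and $d(a_i,a_j)\le 2^{-i}$ for all $i\le j$), and let the closed subsets of $[0,1]^n$ be represented by negative information: $p$ is a name of $A$ if $A=[0,1]^n\setminus\bigcup_{i}B_{p(i)}$, where $(B_m)_m$ is a standard enumeration of the open balls of $[0,1]^n$ with rational centre and rational radius (including the empty ball). Connected choice of dimension $n$ is the multi-valued function $\mathsf{ConC}_n$, $\mathsf{ConC}_n(A)=A$, whose domain consists of the non-empty connected closed sets $A\subseteq[0,1]^n$, with values in $[0,1]^n$. **Theorem (Idempotency).** $$\mathsf{ConC}_1<_W\mathsf{ConC}_1\times\mathsf{ConC}_1<_W\mathsf{ConC}_2.$$ In particular, $\mathsf{ConC}_1$ is not idempotent. -/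

import Mathlib

namespace Weihrauch

/-- Baire space. -/
abbrev Baire : Type := ℕ → ℕ

/-- The prefix `p(0) ... p(k-1)` of length `k`. -/
def prefixOf (p : Baire) (k : ℕ) : List ℕ := (List.range k).map p

/-- The pairing `⟨p, q⟩` with `⟨p, q⟩(2n) = p(n)` and `⟨p, q⟩(2n+1) = q(n)`. -/
def pair (p q : Baire) : Baire := fun k => if k % 2 = 0 then p (k / 2) else q (k / 2)

/-- Computable partial functions on Baire space (type-2 computability): there is a computable
function `h` on finite words, monotone for the prefix order, such that `F p` is the limit of the
words `h (p|k)`. Here `h (p|k)` is what a machine with one-way output has written after it has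
read the prefix of length `k` of its input. As usual, `F p` is defined exactly if infinitely many
symbols are written. -/
def ComputableFun (F : Baire →. Baire) : Prop :=
  ∃ h : List ℕ → List ℕ, Computable h ∧ (∀ u v : List ℕ, u <+: v → h u <+: h v) ∧
    ∀ p q : Baire, q ∈ F p ↔
      (∀ k, ∃ n, h (prefixOf p k) = prefixOf q n) ∧ ∀ n, ∃ k, n ≤ (h (prefixOf p k)).length

/-- A represented space: a set `X` with a surjective partial map from Baire space onto it. The map
is given by its graph: `IsName p x` says that `p` lies in the domain of the representation and is
mapped to `x`. -/
class RepresentedSpace (X : Type*) where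
  IsName : Baire → X → Prop
  unique : ∀ {p x y}, IsName p x → IsName p y → x = y
  surj : ∀ x, ∃ p, IsName p x

open RepresentedSpace (IsName)

/-- A multi-valued partial function; its domain is `{x | (f x).Nonempty}`. -/
abbrev MultiFun (X Y : Type*) := X → Set Y

variable {X Y Z W : Type*} [RepresentedSpace X] [RepresentedSpace Y]
  [RepresentedSpace Z] [RepresentedSpace W]

/-- `F` is a realizer of `f`: every name of a point `x` in the domain of `f` is mapped by the
partial function `F` to a name of some point of `f x`. -/
def Realizes (F : Baire →. Baire) (f : MultiFun X Y) : Prop :=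
  ∀ p x, IsName p x → (f x).Nonempty → ∃ q ∈ F p, ∃ y ∈ f x, IsName q y

/-- The partial function `p ↦ K ⟨p, G (H p)⟩`. -/
def transform (K H G : Baire →. Baire) : Baire →. Baire :=
  fun p => (H p).bind fun q => (G q).bind fun r => K (pair p r)

/-- Weihrauch reducibility `f ≤W g`. -/
def Reducible (f : MultiFun X Y) (g : MultiFun Z W) : Prop :=
  ∃ K H : Baire →. Baire, ComputableFun K ∧ ComputableFun H ∧
    ∀ G : Baire →. Baire, Realizes G g → Realizes (transform K H G) f

/-- Strict Weihrauch reducibility `f <W g`. -/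
def StrictlyReducible (f : MultiFun X Y) (g : MultiFun Z W) : Prop := Reducible f g ∧ ¬ Reducible g f

/-- Weihrauch equivalence. -/
def Equivalent (f : MultiFun X Y) (g : MultiFun Z W) : Prop := Reducible f g ∧ Reducible g f

/-- The product `(f × g)(x, z) = f(x) × g(z)` of multi-valued functions. -/
def product (f : MultiFun X Y) (g : MultiFun Z W) : MultiFun (X × Z) (Y × W) :=
  fun a => f a.1 ×ˢ g a.2

theorem pair_surj (r : Baire) : pair (fun n => r (2 * n)) (fun n => r (2 * n + 1)) = r := by
  funext k
  unfold pair
  split_ifs with h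
  · show r _ = r _
    congr 1; omega
  · show r _ = r _
    congr 1; omega

theorem pair_inj {p q p' q' : Baire} (h : pair p q = pair p' q') : p = p' ∧ q = q' := by
  constructor
  · funext n
    have := congrFun h (2 * n)
    simpa [pair] using this
  · funext n
    have := congrFun h (2 * n + 1)
    have e : (2 * n + 1) / 2 = n := by omega
    simpa [pair, Nat.add_mod, e] using this

/-- The product representation: `⟨p, q⟩` is a name of `(x, y)` iff `p` is a name of `x` and `q` is
a name of `y`. -/
instance : RepresentedSpace (X × Y) where
  IsName r a := ∃ p q, r = pair p q ∧ IsName p a.1 ∧ IsName q a.2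
  unique := by
    rintro r ⟨x, y⟩ ⟨x', y'⟩ ⟨p, q, rfl, hp, hq⟩ ⟨p', q', h, hp', hq'⟩
    obtain ⟨rfl, rfl⟩ := pair_inj h
    exact Prod.ext (RepresentedSpace.unique hp hp') (RepresentedSpace.unique hq hq')
  surj := by
    rintro ⟨x, y⟩
    obtain ⟨p, hp⟩ := RepresentedSpace.surj x
    obtain ⟨q, hq⟩ := RepresentedSpace.surj y
    exact ⟨pair p q, p, q, rfl, hp, hq⟩

/-- `f` is idempotent if `f` is Weihrauch equivalent to `f × f`. -/
def Idempotent (f : MultiFun X Y) : Prop := Equivalent f (product f f)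

/-- Standard enumeration of the non-negative rational numbers. -/
def ratNum (k : ℕ) : ℚ := (Nat.unpair k).1 / ((Nat.unpair k).2 + 1)

/-- The cube `[0,1]^n`, with the maximum metric. -/
abbrev Cube (n : ℕ) : Type := Fin n → unitInterval

/-- Standard enumeration of the rational points of the cube: `k` codes a list of natural numbers,
its `i`-th entry codes the `i`-th coordinate. -/
noncomputable def ratPoint (n k : ℕ) : Cube n := fun i =>
  Set.projIcc (0 : ℝ) 1 zero_le_one (ratNum ((Denumerable.ofNat (List ℕ) k).getD i 0) : ℝ)

/-- Standard enumeration of the open balls of the cube with rational centre and non-negative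
rational radius (a ball of radius `0` is empty). -/
def ratBall (n m : ℕ) : Set (Cube n) :=
  Metric.ball (ratPoint n (Nat.unpair m).1) (ratNum (Nat.unpair m).2 : ℝ)

theorem exists_ratNum (q : ℚ) (hq : 0 ≤ q) : ∃ k, ratNum k = q := by
  refine ⟨Nat.pair q.num.toNat (q.den - 1), ?_⟩
  have h1 : ((q.num.toNat : ℕ) : ℚ) = (q.num : ℚ) := by
    have : ((q.num.toNat : ℕ) : ℤ) = q.num := Int.toNat_of_nonneg (Rat.num_nonneg.mpr hq)
    exact_mod_cast this
  have h2 : ((q.den - 1 : ℕ) : ℚ) + 1 = q.den := by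
    have := q.den_pos
    rw [Nat.cast_sub this]; simp
  simp only [ratNum, Nat.unpair_pair]
  rw [h1, h2, Rat.num_div_den]

theorem exists_ratPoint (n : ℕ) (v : Fin n → ℚ) (h0 : ∀ i, 0 ≤ v i) :
    ∃ k, ∀ i, ratPoint n k i = Set.projIcc (0 : ℝ) 1 zero_le_one (v i : ℝ) := by
  choose c hc using fun i => exists_ratNum (v i) (h0 i)
  refine ⟨Encodable.encode (List.ofFn c), fun i => ?_⟩
  simp [ratPoint, hc]

theorem exists_ratPoint_dist_lt (n : ℕ) (x : Cube n) {ε : ℝ} (hε : 0 < ε) :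
    ∃ k, dist x (ratPoint n k) < ε := by
  have h : ∀ i, ∃ q : ℚ, (x i : ℝ) < q ∧ (q : ℝ) < x i + ε := fun i =>
    exists_rat_btwn (by linarith)
  choose v hv1 hv2 using h
  obtain ⟨k, hk⟩ := exists_ratPoint n v (fun i => by
    have := (x i).2.1
    exact_mod_cast this.trans (hv1 i).le)
  refine ⟨k, (dist_pi_lt_iff hε).2 fun i => ?_⟩
  rw [hk, Subtype.dist_eq, Real.dist_eq, Set.coe_projIcc, abs_lt]
  have := (x i).2.1
  have := (x i).2.2
  have a := hv1 i
  have b := hv2 i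
  rcases le_total (1 : ℝ) (v i) with h | h
  · rw [min_eq_left h, max_eq_right zero_le_one]
    constructor <;> linarith
  · rw [min_eq_right h, max_eq_right (by linarith)]
    constructor <;> linarith

/-- The Cauchy representation of the cube: `p` is a name of `x` if `p` enumerates a rapidly
converging sequence of rational points with limit `x`. -/
noncomputable instance (n : ℕ) : RepresentedSpace (Cube n) where
  IsName p x := (∀ i j, i ≤ j → dist (ratPoint n (p i)) (ratPoint n (p j)) ≤ (1 / 2 : ℝ) ^ i) ∧
    Filter.Tendsto (fun i => ratPoint n (p i)) Filter.atTop (nhds x)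
  unique := fun h h' => tendsto_nhds_unique h.2 h'.2
  surj := by
    intro x
    have hpos : ∀ i : ℕ, (0 : ℝ) < (1 / 2) ^ i / 2 := fun i => by positivity
    choose p hp using fun i => exists_ratPoint_dist_lt n x (hpos i)
    refine ⟨p, fun i j hij => ?_, ?_⟩
    · have h1 : (1 / 2 : ℝ) ^ j ≤ (1 / 2) ^ i :=
        pow_le_pow_of_le_one (by norm_num) (by norm_num) hij
      have h2 := dist_triangle_left (ratPoint n (p i)) (ratPoint n (p j)) x
      have h3 := hp i
      have h4 := hp j
      linarith
    · rw [tendsto_iff_dist_tendsto_zero]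
      refine squeeze_zero (fun _ => dist_nonneg) (fun i => ?_)
        (tendsto_pow_atTop_nhds_zero_of_lt_one (r := (1 / 2 : ℝ)) (by norm_num) (by norm_num))
      have h3 := hp i
      have := hpos i
      rw [dist_comm]
      linarith

/-- The representation of the closed subsets of the cube (the empty set included) by negative
information: `p` is a name of `A` if the rational open balls with indices `p 0, p 1, ...` exhaust
the complement of `A`. -/
instance (n : ℕ) : RepresentedSpace (TopologicalSpace.Closeds (Cube n)) where
  IsName p A := (A : Set (Cube n)) = (⋃ i, ratBall n (p i))ᶜ
  unique := fun h h' => TopologicalSpace.Closeds.ext (h.trans h'.symm)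
  surj := by
    intro A
    have hempty : ∃ m, ratBall n m ⊆ (A : Set (Cube n))ᶜ := by
      obtain ⟨r, hr⟩ := exists_ratNum 0 le_rfl
      exact ⟨Nat.pair 0 r, by simp [ratBall, hr]⟩
    have hS : ({m | ratBall n m ⊆ (A : Set (Cube n))ᶜ}).Nonempty := hempty
    obtain ⟨p, hp⟩ := (Set.to_countable _).exists_eq_range hS
    refine ⟨p, ?_⟩
    rw [← compl_inj_iff, compl_compl]
    ext x
    rw [Set.mem_iUnion]
    constructor
    · intro hx
      obtain ⟨ε, hε, hball⟩ := Metric.isOpen_iff.1 A.isClosed.isOpen_compl x hx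
      obtain ⟨k, hk⟩ := exists_ratPoint_dist_lt n x (half_pos hε)
      obtain ⟨q, hq1, hq2⟩ := exists_rat_btwn hk
      obtain ⟨r, hr⟩ := exists_ratNum q (by
        have : (0 : ℝ) ≤ q := dist_nonneg.trans hq1.le
        exact_mod_cast this)
      have hm : Nat.pair k r ∈ {m | ratBall n m ⊆ (A : Set (Cube n))ᶜ} := by
        intro y hy
        apply hball
        simp only [ratBall, Nat.unpair_pair, hr, Metric.mem_ball] at hy
        rw [Metric.mem_ball]
        have := dist_triangle y (ratPoint n k) x
        rw [dist_comm (ratPoint n k) x] at this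
        linarith
      rw [hp] at hm
      obtain ⟨i, hi⟩ := hm
      refine ⟨i, ?_⟩
      simp only [hi, ratBall, Nat.unpair_pair, hr, Metric.mem_ball]
      exact hq1
    · rintro ⟨i, hi⟩
      have : p i ∈ {m | ratBall n m ⊆ (A : Set (Cube n))ᶜ} := hp ▸ Set.mem_range_self i
      exact this hi

/-- Connected choice of dimension `n`: the multi-valued function that maps a non-empty connected
closed set `A ⊆ [0,1]^n`, given by negative information, to an arbitrary point of `A`. Its domain
consists exactly of the non-empty connected closed sets. -/
def ConC (n : ℕ) : MultiFun (TopologicalSpace.Closeds (Cube n)) (Cube n) :=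
  fun A => {x | IsConnected (A : Set (Cube n)) ∧ x ∈ A}

end Weihrauch

namespace Weihrauch

open RepresentedSpace (IsName)

variable {X Y Z W : Type*} [RepresentedSpace X] [RepresentedSpace Y]
  [RepresentedSpace Z] [RepresentedSpace W]

/-! The upper bounds are direct: an instance is duplicated for `ConC 1`, and a pair of intervals
becomes a rectangle, which is a connected subset of the square. The two lower bounds are
topological. They use only that `K` and `H` are continuous, that the solution set of the queried
instance depends upper semicontinuously on the input name, and that solutions close to each other
are answered, for inputs with a long common prefix, by points close to one point (`local_answer`,
and `uniform_answer` by compactness).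

`ConC 1 × ConC 1` does not reduce to `ConC 1`: start with a name of the full square and shrink it
late to a vertical segment. The solution interval cannot become short, for the second coordinate can
still be shrunk to either endpoint and a short interval of solutions cannot serve both. So for every
vertical segment it meets a fixed finite grid. With more well-separated segments than grid points,
two of them share a solution, whose answers are close together although the segments are not.

`ConC 2` does not reduce to `ConC 1 × ConC 1`: a product of two intervals meets one of countably
many closed probes in exactly one point. Once a finite part of the input forces the answers on probe
`k` to lie near some point of the square, a neighbourhood of that point is removed. Removing only
points with both coordinates in an open set of length at most `1/2` leaves a connected cross, so the
diagonalization defeats all probes at once. -/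

theorem length_prefixOf (p : Baire) (k : ℕ) : (prefixOf p k).length = k := by
  simp [prefixOf]

theorem prefixOf_eq_iff {p q : Baire} {n : ℕ} :
    prefixOf p n = prefixOf q n ↔ ∀ i < n, p i = q i := by
  simp [prefixOf]

theorem prefixOf_succ (p : Baire) (k : ℕ) : prefixOf p (k + 1) = prefixOf p k ++ [p k] := by
  simp [prefixOf, List.range_succ]

theorem pair_congr {p q p' q' : Baire} {k : ℕ} (hp : ∀ i < k, p' i = p i)
    (hq : ∀ i < k, q' i = q i) : ∀ i < k, pair p' q' i = pair p q i := by
  intro i hi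
  have : i / 2 < k := by omega
  simp [pair, hp _ this, hq _ this]

@[simp] theorem pair_even (p q : Baire) (i : ℕ) : pair p q (2 * i) = p i := by
  simp [pair]

@[simp] theorem pair_odd (p q : Baire) (i : ℕ) : pair p q (2 * i + 1) = q i := by
  have e : (2 * i + 1) / 2 = i := by omega
  simp [pair, Nat.add_mod, e]

/-- Continuity of partial functions on Baire space. -/
def ContinuousFun (F : Baire →. Baire) : Prop :=
  ∀ p, ∀ q ∈ F p, ∀ n, ∃ k, ∀ p', (∀ i < k, p' i = p i) → ∀ q' ∈ F p', ∀ i < n, q' i = q i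

theorem ComputableFun.continuousFun {F : Baire →. Baire} (hF : ComputableFun F) :
    ContinuousFun F := by
  obtain ⟨h, -, -, hF⟩ := hF
  intro p q hq n
  obtain ⟨hq1, hq2⟩ := (hF p q).1 hq
  obtain ⟨k, hk⟩ := hq2 n
  refine ⟨k, fun p' hp' q' hq' => ?_⟩
  obtain ⟨m, hm⟩ := hq1 k
  obtain ⟨m', hm'⟩ := ((hF p' q').1 hq').1 k
  rw [prefixOf_eq_iff.2 hp', hm] at hm'
  have hmm : m = m' := by
    have := congrArg List.length hm'
    rwa [length_prefixOf, length_prefixOf] at this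
  subst hmm
  rw [hm, length_prefixOf] at hk
  exact fun i hi => ((prefixOf_eq_iff.1 hm') i (hi.trans_le hk)).symm

/-! ### Reducibility without realizers -/

/-- The pair `K`, `H` reduces `f` to `g`, stated without reference to realizers of `g`. -/
structure IsReduction (K H : Baire →. Baire) (f : MultiFun X Y) (g : MultiFun Z W) : Prop where
  query : ∀ p x, IsName p x → (f x).Nonempty → ∃ s ∈ H p, ∃ z, IsName s z ∧ (g z).Nonempty
  answer : ∀ p x, IsName p x → (f x).Nonempty → ∀ s ∈ H p, ∀ z, IsName s z → ∀ w ∈ g z,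
    ∀ q, IsName q w → ∃ r ∈ K (pair p q), ∃ y ∈ f x, IsName r y

theorem IsReduction.realizes {K H : Baire →. Baire} {f : MultiFun X Y} {g : MultiFun Z W}
    (h : IsReduction K H f g) (G : Baire →. Baire) (hG : Realizes G g) :
    Realizes (transform K H G) f := by
  intro p x hp hx
  obtain ⟨s, hs, z, hz, hne⟩ := h.query p x hp hx
  obtain ⟨q, hq, w, hw, hqw⟩ := hG s z hz hne
  obtain ⟨r, hr, y, hy, hry⟩ := h.answer p x hp hx s hs z hz w hw q hqw
  exact ⟨r, Part.mem_bind hs (Part.mem_bind hq hr), y, hy, hry⟩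

-- A realizer may be chosen to return any prescribed correct answer `q` at one name `s`. The
-- realizers `G a` used here are moreover undefined off names of points of the domain of `g`, so
-- definedness of the composition shows that `H p` is such a name.
open Classical in
theorem isReduction_of_realizes {K H : Baire →. Baire} {f : MultiFun X Y} {g : MultiFun Z W}
    (h : ∀ G : Baire →. Baire, Realizes G g → Realizes (transform K H G) f) :
    IsReduction K H f g := by
  let Good : Baire → Baire → Prop := fun s r => ∃ z, ∃ w ∈ g z, IsName s z ∧ IsName r w
  let G : (Baire × Baire) → Baire →. Baire := fun a s =>
    ⟨∃ r, Good s r, fun h => if Good a.1 a.2 ∧ s = a.1 then a.2 else h.choose⟩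
  have hgood : ∀ a s, ∀ r ∈ G a s, Good s r := by
    rintro a s r ⟨hd, rfl⟩
    by_cases hc : Good a.1 a.2 ∧ s = a.1
    · simp only [G, if_pos hc]
      rw [hc.2]
      exact hc.1
    · simp only [G, if_neg hc]
      exact Exists.choose_spec hd
  have hreal : ∀ a, Realizes (G a) g := by
    rintro a s z hz ⟨w, hw⟩
    obtain ⟨r, hr⟩ := RepresentedSpace.surj w
    have hd : (G a s).Dom := ⟨r, z, w, hw, hz, hr⟩
    obtain ⟨z', w', hw', hz', hr'⟩ := hgood a s _ (Part.get_mem hd)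
    rw [RepresentedSpace.unique hz' hz] at hw'
    exact ⟨_, Part.get_mem hd, w', hw', hr'⟩
  constructor
  · intro p x hp hx
    obtain ⟨r, hr, -⟩ := h (G (p, p)) (hreal _) p x hp hx
    obtain ⟨s, hs, hr⟩ := Part.mem_bind_iff.1 hr
    obtain ⟨q, hq, -⟩ := Part.mem_bind_iff.1 hr
    obtain ⟨z, w, hw, hz, -⟩ := hgood _ _ _ hq
    exact ⟨s, hs, z, hz, w, hw⟩
  · intro p x hp hx s hs z hz w hw q hq
    obtain ⟨r, hr, y, hy, hry⟩ := h (G (s, q)) (hreal _) p x hp hx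
    obtain ⟨s', hs', hr⟩ := Part.mem_bind_iff.1 hr
    obtain rfl := Part.mem_unique hs hs'
    obtain ⟨q', ⟨hd, hq'⟩, hr⟩ := Part.mem_bind_iff.1 hr
    have hc : Good s q ∧ s = s := ⟨⟨z, w, hw, hz, hq⟩, rfl⟩
    obtain rfl : q = q' := (if_pos hc).symm.trans hq'
    exact ⟨r, hr, y, hy, hry⟩

theorem reducible_iff {f : MultiFun X Y} {g : MultiFun Z W} :
    Reducible f g ↔ ∃ K H, ComputableFun K ∧ ComputableFun H ∧ IsReduction K H f g :=
  ⟨fun ⟨K, H, hK, hH, h⟩ => ⟨K, H, hK, hH, isReduction_of_realizes h⟩,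
    fun ⟨K, H, hK, hH, h⟩ => ⟨K, H, hK, hH, h.realizes⟩⟩

/-! ### Continuity properties of reductions -/

/-- A representation of a metric space that is continuous. -/
def ContinuousRep (Y : Type*) [RepresentedSpace Y] [PseudoMetricSpace Y] : Prop :=
  ∀ (s : Baire) (y : Y), IsName s y → ∀ ε > 0, ∃ n, ∀ s' y', IsName s' y' →
    (∀ i < n, s' i = s i) → dist y' y ≤ ε

/-- Every point has a name all of whose prefixes extend to names of all nearby points. -/
def OpenRep (W : Type*) [RepresentedSpace W] [PseudoMetricSpace W] : Prop :=
  ∀ w : W, ∃ q, IsName q w ∧ ∀ n, ∃ η > 0, ∀ w', dist w' w < η →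
    ∃ q', IsName q' w' ∧ ∀ i < n, q' i = q i

/-- The graph of `g`, restricted to names of points of the domain of `g`, is closed. -/
def ClosedGraph [PseudoMetricSpace W] (g : MultiFun Z W) : Prop :=
  ∀ s z, IsName s z → (g z).Nonempty → ∀ w ∉ g z, ∃ n, ∃ η > 0, ∀ s' z', IsName s' z' →
    (∀ i < n, s' i = s i) → ∀ w' ∈ g z', η ≤ dist w' w

/-- The set of solutions of the instance of `g` with name `H p`. -/
def solutions (H : Baire →. Baire) (g : MultiFun Z W) (p : Baire) : Set W :=
  {w | ∃ s ∈ H p, ∃ z, IsName s z ∧ w ∈ g z}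

omit [RepresentedSpace W] in
theorem solutions_eq {H : Baire →. Baire} {g : MultiFun Z W} {p s : Baire} {z : Z}
    (hs : s ∈ H p) (hz : IsName s z) : solutions H g p = g z := by
  ext w
  constructor
  · rintro ⟨s', hs', z', hz', hw⟩
    obtain rfl := Part.mem_unique hs hs'
    rwa [RepresentedSpace.unique hz hz']
  · exact fun hw => ⟨s, hs, z, hz, hw⟩

namespace IsReduction

variable {K H : Baire →. Baire} {f : MultiFun X Y} {g : MultiFun Z W}

theorem exists_solutions_eq (h : IsReduction K H f g) {p : Baire} {x : X} (hp : IsName p x)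
    (hx : (f x).Nonempty) : ∃ z, (g z).Nonempty ∧ solutions H g p = g z := by
  obtain ⟨s, hs, z, hz, hne⟩ := h.query p x hp hx
  exact ⟨z, hne, solutions_eq hs hz⟩

theorem solutions_nonempty (h : IsReduction K H f g) {p : Baire} {x : X} (hp : IsName p x)
    (hx : (f x).Nonempty) : (solutions H g p).Nonempty := by
  obtain ⟨z, hne, he⟩ := h.exists_solutions_eq hp hx
  rwa [he]

theorem solutions_away [PseudoMetricSpace W] (h : IsReduction K H f g) (hH : ContinuousFun H)
    (hg : ClosedGraph g) {p : Baire} {x : X} (hp : IsName p x) (hx : (f x).Nonempty) {w : W}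
    (hw : w ∉ solutions H g p) :
    ∃ n, ∃ η > 0, ∀ p', (∀ i < n, p' i = p i) → ∀ w' ∈ solutions H g p', η ≤ dist w' w := by
  obtain ⟨s, hs, z, hz, hne⟩ := h.query p x hp hx
  rw [solutions_eq hs hz] at hw
  obtain ⟨n, η, hη, hn⟩ := hg s z hz hne w hw
  obtain ⟨k, hk⟩ := hH p s hs n
  refine ⟨k, η, hη, fun p' hp' w' hw' => ?_⟩
  obtain ⟨s', hs', z', hz', hw'⟩ := hw'
  exact hn s' z' hz' (hk p' hp' s' hs') w' hw'

/-- The solution sets depend upper semicontinuously on the instance. -/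
theorem solutions_subset [PseudoMetricSpace W] [CompactSpace W] (h : IsReduction K H f g)
    (hH : ContinuousFun H) (hg : ClosedGraph g) {p : Baire} {x : X} (hp : IsName p x)
    (hx : (f x).Nonempty) {U : Set W} (hU : IsOpen U) (hsub : solutions H g p ⊆ U) :
    ∃ n, ∀ p', (∀ i < n, p' i = p i) → solutions H g p' ⊆ U := by
  have key : ∃ n, ∀ p', (∀ i < n, p' i = p i) → ∀ w ∈ solutions H g p', w ∉ Uᶜ := by
    refine hU.isClosed_compl.isCompact.induction_on
      (p := fun t => ∃ n, ∀ p', (∀ i < n, p' i = p i) → ∀ w ∈ solutions H g p', w ∉ t)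
      ⟨0, fun _ _ _ _ => id⟩ ?_ ?_ ?_
    · rintro t t' ht ⟨n, hn⟩
      exact ⟨n, fun p' hp' w hw hwt => hn p' hp' w hw (ht hwt)⟩
    · rintro t t' ⟨n, hn⟩ ⟨n', hn'⟩
      refine ⟨max n n', fun p' hp' w hw hwt => hwt.elim ?_ ?_⟩
      · exact hn p' (fun i hi => hp' i (lt_max_of_lt_left hi)) w hw
      · exact hn' p' (fun i hi => hp' i (lt_max_of_lt_right hi)) w hw
    · intro w hw
      obtain ⟨n, η, hη, hn⟩ := h.solutions_away hH hg hp hx (fun h' => hw (hsub h'))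
      refine ⟨Metric.ball w η, mem_nhdsWithin_of_mem_nhds (Metric.ball_mem_nhds w hη), n, ?_⟩
      intro p' hp' w' hw' hb
      exact (hn p' hp' w' hw').not_gt hb
  obtain ⟨n, hn⟩ := key
  exact ⟨n, fun p' hp' w hw => not_not.1 (hn p' hp' w hw)⟩

/-- Solutions near a given point are answered, for instances close to a given one, by points close
to a single point. -/
theorem local_answer [PseudoMetricSpace W] [PseudoMetricSpace Y] (h : IsReduction K H f g)
    (hK : ContinuousFun K) (hH : ContinuousFun H) (hg : ClosedGraph g) (hY : ContinuousRep Y)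
    (hW : OpenRep W) {p : Baire} {x : X} (hp : IsName p x) (hx : (f x).Nonempty) (w : W) {ε : ℝ}
    (hε : 0 < ε) :
    ∃ y₀ : Y, ∃ n, ∃ η > 0, ∀ p' x', IsName p' x' → (f x').Nonempty → (∀ i < n, p' i = p i) →
      ∀ w' ∈ solutions H g p', dist w' w < η → ∃ y ∈ f x', dist y y₀ ≤ ε := by
  by_cases hw : w ∈ solutions H g p
  · obtain ⟨s, hs, z, hz, hwz⟩ := hw
    obtain ⟨q, hq, hq'⟩ := hW w
    obtain ⟨r, hr, y, hy, hry⟩ := h.answer p x hp hx s hs z hz w hwz q hq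
    obtain ⟨n, hn⟩ := hY r y hry ε hε
    obtain ⟨k, hk⟩ := hK _ r hr n
    obtain ⟨η, hη, hball⟩ := hq' k
    refine ⟨y, k, η, hη, fun p' x' hp' hx' hpp' w' hw' hd => ?_⟩
    obtain ⟨s', hs', z', hz', hwz'⟩ := hw'
    obtain ⟨q', hqw', hqq'⟩ := hball w' hd
    obtain ⟨r', hr', y', hy', hry'⟩ := h.answer p' x' hp' hx' s' hs' z' hz' w' hwz' q' hqw'
    exact ⟨y', hy', hn r' y' hry' (hk _ (pair_congr hpp' hqq') r' hr')⟩
  · obtain ⟨n, η, hη, hn⟩ := h.solutions_away hH hg hp hx hw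
    -- No nearby instance has a solution near `w`, so the choice of `y₀` is irrelevant.
    refine ⟨hx.some, n, η, hη, fun p' x' hp' hx' hpp' w' hw' hd => ?_⟩
    exact absurd hd (hn p' hpp' w' hw').not_gt

/-- A version of `local_answer` that is uniform in the solution. -/
theorem uniform_answer [PseudoMetricSpace W] [CompactSpace W] [PseudoMetricSpace Y]
    (h : IsReduction K H f g) (hK : ContinuousFun K) (hH : ContinuousFun H) (hg : ClosedGraph g)
    (hY : ContinuousRep Y) (hW : OpenRep W) {p : Baire} {x : X} (hp : IsName p x)
    (hx : (f x).Nonempty) {ε : ℝ} (hε : 0 < ε) :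
    ∃ n, ∃ η > 0, ∀ w : W, ∃ y₀ : Y, ∀ p' x', IsName p' x' → (f x').Nonempty →
      (∀ i < n, p' i = p i) → ∀ w' ∈ solutions H g p', dist w' w < η →
        ∃ y ∈ f x', dist y y₀ ≤ ε := by
  have key : ∃ n, ∃ η > 0, ∀ w ∈ (Set.univ : Set W), ∃ y₀ : Y, ∀ p' x', IsName p' x' →
      (f x').Nonempty → (∀ i < n, p' i = p i) → ∀ w' ∈ solutions H g p', dist w' w < η →
        ∃ y ∈ f x', dist y y₀ ≤ ε := by
    refine isCompact_univ.induction_on (p := fun t => ∃ n, ∃ η > 0, ∀ w ∈ t, ∃ y₀ : Y, ∀ p' x',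
      IsName p' x' → (f x').Nonempty → (∀ i < n, p' i = p i) → ∀ w' ∈ solutions H g p',
        dist w' w < η → ∃ y ∈ f x', dist y y₀ ≤ ε) ⟨0, 1, one_pos, fun _ h => h.elim⟩ ?_ ?_ ?_
    · rintro t t' ht ⟨n, η, hη, hn⟩
      exact ⟨n, η, hη, fun w hw => hn w (ht hw)⟩
    · rintro t t' ⟨n, η, hη, hn⟩ ⟨n', η', hη', hn'⟩
      refine ⟨max n n', min η η', lt_min hη hη', fun w hw => ?_⟩
      rcases hw with hw | hw
      · obtain ⟨y₀, hy⟩ := hn w hw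
        exact ⟨y₀, fun p' x' hp' hx' hpp' w' hw' hd => hy p' x' hp' hx'
          (fun i hi => hpp' i (lt_max_of_lt_left hi)) w' hw' (hd.trans_le (min_le_left _ _))⟩
      · obtain ⟨y₀, hy⟩ := hn' w hw
        exact ⟨y₀, fun p' x' hp' hx' hpp' w' hw' hd => hy p' x' hp' hx'
          (fun i hi => hpp' i (lt_max_of_lt_right hi)) w' hw' (hd.trans_le (min_le_right _ _))⟩
    · intro w _
      obtain ⟨y₀, n, η, hη, hn⟩ := h.local_answer hK hH hg hY hW hp hx w hε
      -- Halving the radius absorbs the move of the centre from `w` to `v`.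
      refine ⟨Metric.ball w (η / 2), mem_nhdsWithin_of_mem_nhds
        (Metric.ball_mem_nhds w (half_pos hη)), n, η / 2, half_pos hη, fun v hv => ⟨y₀, ?_⟩⟩
      intro p' x' hp' hx' hpp' w' hw' hd
      refine hn p' x' hp' hx' hpp' w' hw' ?_
      have := dist_triangle w' v w
      rw [Metric.mem_ball] at hv
      linarith
  obtain ⟨n, η, hη, hn⟩ := key
  exact ⟨n, η, hη, fun w => hn w trivial⟩

end IsReduction

/-! ### Topology of the representations of products, cubes and closed sets -/

theorem ContinuousRep.prod {Y Y' : Type*} [RepresentedSpace Y] [RepresentedSpace Y']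
    [PseudoMetricSpace Y] [PseudoMetricSpace Y'] (h : ContinuousRep Y) (h' : ContinuousRep Y') :
    ContinuousRep (Y × Y') := by
  rintro s ⟨y, y'⟩ ⟨p, q, rfl, hp, hq⟩ ε hε
  obtain ⟨n, hn⟩ := h p y hp ε hε
  obtain ⟨n', hn'⟩ := h' q y' hq ε hε
  refine ⟨2 * max n n', ?_⟩
  rintro s' ⟨v, v'⟩ ⟨p', q', rfl, hp', hq'⟩ hs
  refine max_le (hn p' v hp' fun i hi => ?_) (hn' q' v' hq' fun i hi => ?_)
  · have := hs (2 * i) (by have := le_max_left n n'; omega)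
    simpa using this
  · have := hs (2 * i + 1) (by have := le_max_right n n'; omega)
    simpa using this

theorem OpenRep.prod {Y Y' : Type*} [RepresentedSpace Y] [RepresentedSpace Y']
    [PseudoMetricSpace Y] [PseudoMetricSpace Y'] (h : OpenRep Y) (h' : OpenRep Y') :
    OpenRep (Y × Y') := by
  rintro ⟨y, y'⟩
  obtain ⟨p, hp, hp'⟩ := h y
  obtain ⟨q, hq, hq'⟩ := h' y'
  refine ⟨pair p q, ⟨p, q, rfl, hp, hq⟩, fun n => ?_⟩
  obtain ⟨η, hη, hn⟩ := hp' n
  obtain ⟨η', hη', hn'⟩ := hq' n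
  refine ⟨min η η', lt_min hη hη', ?_⟩
  rintro ⟨v, v'⟩ hd
  rw [Prod.dist_eq, max_lt_iff] at hd
  obtain ⟨r, hr, hr'⟩ := hn v (hd.1.trans_le (min_le_left _ _))
  obtain ⟨t, ht, ht'⟩ := hn' v' (hd.2.trans_le (min_le_right _ _))
  exact ⟨pair r t, ⟨r, t, rfl, hr, ht⟩, pair_congr hr' ht'⟩

theorem ClosedGraph.product {Z' W W' : Type*} [RepresentedSpace Z']
    [PseudoMetricSpace W] [PseudoMetricSpace W'] {g : MultiFun Z W} {g' : MultiFun Z' W'}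
    (h : ClosedGraph g) (h' : ClosedGraph g') : ClosedGraph (product g g') := by
  rintro s ⟨z, z'⟩ ⟨p, q, rfl, hp, hq⟩ hne ⟨w, w'⟩ hw
  have hne' : (g z).Nonempty ∧ (g' z').Nonempty := Set.prod_nonempty_iff.1 hne
  have hw' : ¬ (w ∈ g z ∧ w' ∈ g' z') := hw
  by_cases hwz : w ∈ g z
  · obtain ⟨n, η, hη, hn⟩ := h' q z' hq hne'.2 w' fun h => hw' ⟨hwz, h⟩
    refine ⟨2 * n, η, hη, ?_⟩
    rintro s' ⟨v, v'⟩ ⟨p', q', rfl, hp', hq'⟩ hs ⟨u, u'⟩ hu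
    refine le_max_of_le_right (hn q' v' hq' (fun i hi => ?_) u' hu.2)
    simpa using hs (2 * i + 1) (by omega)
  · obtain ⟨n, η, hη, hn⟩ := h p z hp hne'.1 w hwz
    refine ⟨2 * n, η, hη, ?_⟩
    rintro s' ⟨v, v'⟩ ⟨p', q', rfl, hp', hq'⟩ hs ⟨u, u'⟩ hu
    refine le_max_of_le_left (hn p' v hp' (fun i hi => ?_) u hu.1)
    simpa using hs (2 * i) (by omega)

theorem dist_ratPoint_le_of_isName {n : ℕ} {p : Baire} {x : Cube n} (h : IsName p x) (i : ℕ) :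
    dist (ratPoint n (p i)) x ≤ (1 / 2 : ℝ) ^ i :=
  le_of_tendsto (tendsto_const_nhds.dist h.2)
    (Filter.eventually_atTop.2 ⟨i, fun j hj => h.1 i j hj⟩)

theorem isName_of_dist_lt {n : ℕ} {p : Baire} {x : Cube n}
    (h : ∀ i, dist x (ratPoint n (p i)) < (1 / 2 : ℝ) ^ i / 2) : IsName p x := by
  refine ⟨fun i j hij => ?_, ?_⟩
  · have h1 : (1 / 2 : ℝ) ^ j ≤ (1 / 2) ^ i :=
      pow_le_pow_of_le_one (by norm_num) (by norm_num) hij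
    have h2 := dist_triangle_left (ratPoint n (p i)) (ratPoint n (p j)) x
    have h3 := h i
    have h4 := h j
    linarith
  · rw [tendsto_iff_dist_tendsto_zero]
    refine squeeze_zero (fun _ => dist_nonneg) (fun i => ?_)
      (tendsto_pow_atTop_nhds_zero_of_lt_one (r := (1 / 2 : ℝ)) (by norm_num) (by norm_num))
    have h3 := h i
    have : (0 : ℝ) < (1 / 2) ^ i := by positivity
    rw [dist_comm]
    linarith

theorem continuousRep_cube (n : ℕ) : ContinuousRep (Cube n) := by
  intro s y hs ε hε
  obtain ⟨k, hk⟩ := exists_pow_lt_of_lt_one (half_pos hε) (by norm_num : (1 / 2 : ℝ) < 1)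
  refine ⟨k + 1, fun s' y' hs' hss' => ?_⟩
  have h1 := dist_ratPoint_le_of_isName hs k
  have h2 := dist_ratPoint_le_of_isName hs' k
  rw [hss' k (Nat.lt_succ_self k)] at h2
  have := dist_triangle_left y' y (ratPoint n (s k))
  linarith

/-- A name with errors strictly below half of the allowed tolerance has slack: finitely many of its
terms remain admissible for every sufficiently close point. -/
theorem openRep_cube (n : ℕ) : OpenRep (Cube n) := by
  have hpos : ∀ i : ℕ, (0 : ℝ) < (1 / 2) ^ i / 2 := fun i => by positivity
  choose a ha using fun (x : Cube n) i => exists_ratPoint_dist_lt n x (hpos i)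
  intro x
  refine ⟨a x, isName_of_dist_lt (ha x), fun k => ?_⟩
  have : ∃ η > 0, ∀ y, dist y x < η → ∀ i < k, dist y (ratPoint n (a x i)) < (1 / 2 : ℝ) ^ i / 2 := by
    have hev : ∀ᶠ y in nhds x, ∀ i ∈ Finset.range k,
        dist y (ratPoint n (a x i)) < (1 / 2 : ℝ) ^ i / 2 := by
      rw [Filter.eventually_all_finset]
      intro i _
      exact (continuous_id.dist continuous_const).continuousAt.eventually_lt_const (ha x i)
    obtain ⟨η, hη, h⟩ := Metric.eventually_nhds_iff.1 hev
    exact ⟨η, hη, fun y hy i hi => h hy i (Finset.mem_range.2 hi)⟩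
  obtain ⟨η, hη, h⟩ := this
  refine ⟨η, hη, fun y hy => ⟨fun i => if i < k then a x i else a y i,
    isName_of_dist_lt fun i => ?_, fun i hi => if_pos hi⟩⟩
  split_ifs with hi
  · exact h y hy i hi
  · exact ha y i

/-- A point outside `A` lies in a ball listed after finitely many symbols, and every set whose name
shares these symbols also avoids that ball. -/
theorem closedGraph_conC (n : ℕ) : ClosedGraph (ConC n) := by
  rintro s A hs ⟨x, hA, -⟩ w hw
  have hwA : w ∉ (A : Set (Cube n)) := fun h => hw ⟨hA, h⟩
  have hs' : (A : Set (Cube n)) = (⋃ i, ratBall n (s i))ᶜ := hs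
  rw [hs', Set.mem_compl_iff, not_not, Set.mem_iUnion] at hwA
  obtain ⟨i, hi⟩ := hwA
  obtain ⟨η, hη, hsub⟩ := Metric.isOpen_iff.1 Metric.isOpen_ball w hi
  refine ⟨i + 1, η, hη, fun s' B hB hss w' hw' => ?_⟩
  by_contra! hlt
  have hB' : (B : Set (Cube n)) = (⋃ i, ratBall n (s' i))ᶜ := hB
  have hw'' := hw'.2
  rw [← SetLike.mem_coe, hB'] at hw''
  refine hw'' (Set.mem_iUnion.2 ⟨i, ?_⟩)
  rw [hss i (Nat.lt_succ_self i)]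
  exact hsub hlt

/-! ### The computable reductions -/

/-- The `n`-th output symbol of `letterwise g φ` is computed from `n` and the input symbol at
position `φ n`. -/
def letterwise (g : ℕ → ℕ → ℕ) (φ : ℕ → ℕ) : Baire →. Baire :=
  fun p => Part.some fun n => g n (p (φ n))

/-- The machine writes one symbol for every four read: position `φ n ≤ 4 * n + 3` is known once `4 *
(n + 1)` symbols have been read. -/
theorem computableFun_letterwise {g : ℕ → ℕ → ℕ} {φ : ℕ → ℕ} (hg : Primrec₂ g) (hφ : Primrec φ)
    (hb : ∀ n, φ n ≤ 4 * n + 3) : ComputableFun (letterwise g φ) := by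
  have hpre : ∀ (p : Baire) (k : ℕ), (List.range ((prefixOf p k).length / 4)).map
      (fun n => g n ((prefixOf p k).getD (φ n) 0)) = prefixOf (fun n => g n (p (φ n))) (k / 4) := by
    intro p k
    rw [length_prefixOf]
    refine List.map_congr_left fun n hn => ?_
    rw [List.mem_range] at hn
    have : φ n < k := by have := hb n; omega
    simp [prefixOf, List.getD_eq_getElem?_getD, this]
  refine ⟨fun u => (List.range (u.length / 4)).map fun n => g n (u.getD (φ n) 0), ?_, ?_, ?_⟩
  · apply Primrec.to_comp
    refine Primrec.list_map (Primrec.list_range.comp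
      (Primrec.nat_div.comp Primrec.list_length (Primrec.const 4))) ?_
    exact hg.comp₂ Primrec₂.right ((Primrec.list_getD 0).comp₂ Primrec₂.left
      (hφ.comp₂ Primrec₂.right))
  · rintro u v ⟨w, rfl⟩
    obtain ⟨d, hd⟩ := Nat.exists_eq_add_of_le
      (Nat.div_le_div_right (c := 4) (by simp : u.length ≤ (u ++ w).length))
    refine ⟨((List.range d).map (u.length / 4 + ·)).map
      fun n => g n ((u ++ w).getD (φ n) 0), ?_⟩
    dsimp only
    rw [hd, List.range_add, List.map_append]
    congr 1
    refine List.map_congr_left fun n hn => ?_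
    rw [List.mem_range] at hn
    have : φ n < u.length := by have := hb n; omega
    rw [List.getD_append _ _ _ _ this]
  · intro p q
    simp only [letterwise, Part.mem_some_iff, hpre]
    simp only [length_prefixOf]
    constructor
    · rintro rfl
      exact ⟨fun k => ⟨_, rfl⟩, fun n => ⟨4 * n, by omega⟩⟩
    · rintro ⟨h1, h2⟩
      funext n
      obtain ⟨k, hk⟩ := h2 (n + 1)
      obtain ⟨m, hm⟩ := h1 k
      obtain rfl : k / 4 = m := by
        have := congrArg List.length hm
        rwa [length_prefixOf, length_prefixOf] at this
      exact ((prefixOf_eq_iff.1 hm) n hk).symm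

theorem reducible_product_self {X Y : Type*} [RepresentedSpace X] [RepresentedSpace Y]
    (f : MultiFun X Y) : Reducible f (product f f) := by
  -- In `⟨p, ⟨c, d⟩⟩` the symbol `c n` stands at position `4 * n + 1`; reading position `n / 2`
  -- produces `⟨p, p⟩`.
  refine reducible_iff.2 ⟨letterwise (fun _ m => m) (fun n => 4 * n + 1),
    letterwise (fun _ m => m) (fun n => n / 2), ?_, ?_, ?_, ?_⟩
  · exact computableFun_letterwise Primrec₂.right
      (Primrec.nat_add.comp (Primrec.nat_mul.comp (Primrec.const 4) Primrec.id) (Primrec.const 1))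
      (fun n => by omega)
  · exact computableFun_letterwise Primrec₂.right
      (Primrec.nat_div.comp Primrec.id (Primrec.const 2)) (fun n => by omega)
  · intro p x hp hx
    refine ⟨_, Part.mem_some _, (x, x), ⟨p, p, ?_, hp, hp⟩, hx.prod hx⟩
    funext k
    simp [pair]
  · rintro p x hp hx s hs ⟨z, z'⟩ ⟨a, b, rfl, ha, hb⟩ ⟨w, w'⟩ hw q ⟨c, d, rfl, hc, hd⟩
    refine ⟨_, Part.mem_some _, w, ?_, ?_⟩
    · rw [letterwise, Part.mem_some_iff] at hs
      have : a = p := by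
        funext k
        have := congrFun hs (2 * k)
        simpa using this
      subst this
      rw [RepresentedSpace.unique hp ha]
      exact hw.1
    · have : (fun n => pair p (pair c d) (4 * n + 1)) = c := by
        funext n
        have e : 4 * n + 1 = 2 * (2 * n) + 1 := by ring
        rw [e, pair_odd, pair_even]
      rw [this]
      exact hc

/-- The code of the `i`-th coordinate of the rational point with code `k`. -/
def coordCode (k i : ℕ) : ℕ := (Denumerable.ofNat (List ℕ) k).getD i 0

theorem primrec_coordCode : Primrec₂ coordCode :=
  (Primrec.list_getD 0).comp₂ ((Primrec.ofNat (List ℕ)).comp₂ Primrec₂.left) Primrec₂.right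

/-- The rational point of the unit interval with code `c`. -/
noncomputable def ratCoord (c : ℕ) : unitInterval := Set.projIcc (0 : ℝ) 1 zero_le_one (ratNum c : ℝ)

theorem ratPoint_apply (n k : ℕ) (i : Fin n) : ratPoint n k i = ratCoord (coordCode k i) := rfl

theorem coordCode_encode (l : List ℕ) (i : ℕ) :
    coordCode (Encodable.encode l) i = l.getD i 0 := by
  simp [coordCode]

theorem dist_cube_one (x y : Cube 1) : dist x y = dist (x 0) (y 0) := by
  rw [dist_pi_def]
  simp

theorem dist_cube_two (x y : Cube 2) :
    dist x y = max (dist (x 0) (y 0)) (dist (x 1) (y 1)) := by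
  refine le_antisymm ((dist_pi_le_iff (le_max_of_le_left dist_nonneg)).2 ?_)
    (max_le (dist_le_pi_dist x y 0) (dist_le_pi_dist x y 1))
  exact Fin.forall_fin_two.2 ⟨le_max_left _ _, le_max_right _ _⟩

theorem exists_ratCoord_dist_lt (a : unitInterval) {ε : ℝ} (hε : 0 < ε) :
    ∃ c, dist a (ratCoord c) < ε := by
  obtain ⟨k, hk⟩ := exists_ratPoint_dist_lt 1 (fun _ => a) hε
  exact ⟨coordCode k (0 : Fin 1), by rwa [dist_cube_one] at hk⟩

/-- The set of points whose coordinates lie in `A` and `B`. -/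
def rectangle (A B : TopologicalSpace.Closeds (Cube 1)) : TopologicalSpace.Closeds (Cube 2) where
  carrier := {x | (fun _ => x 0) ∈ A ∧ (fun _ => x 1) ∈ B}
  isClosed' := (A.isClosed.preimage (by fun_prop : Continuous fun x : Cube 2 => fun _ : Fin 1 => x 0)).inter
    (B.isClosed.preimage (by fun_prop : Continuous fun x : Cube 2 => fun _ : Fin 1 => x 1))

theorem mem_rectangle {A B : TopologicalSpace.Closeds (Cube 1)} {x : Cube 2} :
    x ∈ rectangle A B ↔ (fun _ => x 0) ∈ A ∧ (fun _ => x 1) ∈ B := Iff.rfl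

theorem isConnected_rectangle {A B : TopologicalSpace.Closeds (Cube 1)}
    (hA : IsConnected (A : Set (Cube 1))) (hB : IsConnected (B : Set (Cube 1))) :
    IsConnected (rectangle A B : Set (Cube 2)) := by
  have : (rectangle A B : Set (Cube 2)) =
      (fun z : Cube 1 × Cube 1 => (![z.1 0, z.2 0] : Cube 2)) '' ((A : Set (Cube 1)) ×ˢ B) := by
    ext x
    constructor
    · rintro ⟨h0, h1⟩
      refine ⟨(fun _ => x 0, fun _ => x 1), ⟨h0, h1⟩, ?_⟩
      funext i
      fin_cases i <;> rfl
    · rintro ⟨⟨a, b⟩, ⟨ha, hb⟩, rfl⟩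
      have e : ∀ c : Cube 1, (fun _ => c 0) = c := fun c => funext fun i => by
        rw [Subsingleton.elim i 0]
      exact ⟨by simpa [e] using ha, by simpa [e] using hb⟩
  rw [this]
  refine (hA.prod hB).image _ (Continuous.continuousOn ?_)
  refine continuous_pi fun i => ?_
  fin_cases i
  · change Continuous fun z : Cube 1 × Cube 1 => z.1 0
    fun_prop
  · change Continuous fun z : Cube 1 × Cube 1 => z.2 0
    fun_prop

/-- Codes for the balls of the strip over the ball with code `m`, which is perpendicular to the
first or second axis, depending on the parity of `n.unpair.1`. -/
def stripCode (n m : ℕ) : ℕ :=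
  Nat.pair (Encodable.encode (bif n.unpair.1.bodd then [n.unpair.2, coordCode m.unpair.1 0]
    else [coordCode m.unpair.1 0, n.unpair.2])) m.unpair.2

theorem primrec_stripCode : Primrec₂ stripCode := by
  have hc : Primrec₂ fun _ m : ℕ => coordCode m.unpair.1 0 :=
    primrec_coordCode.comp₂ ((Primrec.fst.comp Primrec.unpair).comp₂ Primrec₂.right)
      (Primrec₂.const 0)
  have hj : Primrec₂ fun n _ : ℕ => n.unpair.2 :=
    (Primrec.snd.comp Primrec.unpair).comp₂ Primrec₂.left
  have hl : ∀ {a b : ℕ → ℕ → ℕ}, Primrec₂ a → Primrec₂ b →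
      Primrec₂ fun n m => ([a n m, b n m] : List ℕ) := fun ha hb =>
    Primrec.list_cons.comp₂ ha (Primrec.list_cons.comp₂ hb (Primrec₂.const []))
  refine Primrec₂.natPair.comp₂ (Primrec.encode.comp₂ ?_)
    ((Primrec.snd.comp Primrec.unpair).comp₂ Primrec₂.right)
  exact Primrec.cond (Primrec.nat_bodd.comp (Primrec.fst.comp (Primrec.unpair.comp Primrec.fst)))
    (hl hj hc) (hl hc hj)

theorem dist_lt_of_dist_lt {r : ℝ} {a b : unitInterval} (h : dist a b < r) : 0 < r :=
  dist_nonneg.trans_lt h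

/-- For the maximum metric a ball is a product of intervals. When its centre runs through all
rational values of the free coordinate, density makes these balls fill the whole strip; a ball
containing a point has positive radius. -/
theorem mem_iUnion_ratBall_strip (p q : Baire) (x : Cube 2) :
    x ∈ ⋃ n, ratBall 2 (stripCode n (pair p q n.unpair.1)) ↔
      (fun _ => x 0) ∈ (⋃ i, ratBall 1 (p i)) ∨ (fun _ => x 1) ∈ ⋃ i, ratBall 1 (q i) := by
  simp only [Set.mem_iUnion, ratBall, Metric.mem_ball, dist_cube_one, dist_cube_two,
    ratPoint_apply, stripCode, Nat.unpair_pair, coordCode_encode, max_lt_iff]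
  constructor
  · rintro ⟨n, h0, h1⟩
    rcases Nat.even_or_odd' n.unpair.1 with ⟨i, hi | hi⟩
    · left
      refine ⟨i, ?_⟩
      simpa [hi] using h0
    · right
      refine ⟨i, ?_⟩
      simpa [hi] using h1
  · rintro (⟨i, hi⟩ | ⟨i, hi⟩)
    · obtain ⟨c, hc⟩ := exists_ratCoord_dist_lt (x 1) (dist_lt_of_dist_lt hi)
      refine ⟨Nat.pair (2 * i) c, ?_, ?_⟩
      · simpa using hi
      · simpa using hc
    · obtain ⟨c, hc⟩ := exists_ratCoord_dist_lt (x 0) (dist_lt_of_dist_lt hi)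
      refine ⟨Nat.pair (2 * i + 1) c, ?_, ?_⟩
      · simpa using hc
      · simpa using hi

theorem isName_coordinate {n : ℕ} {p : Baire} {x : Cube n} (h : IsName p x) (i : Fin n) :
    IsName (fun k => Encodable.encode [coordCode (p k) i]) (fun _ : Fin 1 => x i) := by
  have e : ∀ k, ratPoint 1 (Encodable.encode [coordCode (p k) i]) =
      fun _ => ratPoint n (p k) i := by
    intro k
    funext j
    rw [Subsingleton.elim j 0, ratPoint_apply, ratPoint_apply, coordCode_encode]
    simp
  constructor
  · intro k l hkl
    rw [e, e, dist_cube_one]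
    exact (dist_le_pi_dist _ _ i).trans (h.1 k l hkl)
  · simp only [e]
    refine tendsto_pi_nhds.2 fun _ => ?_
    exact (tendsto_pi_nhds.1 h.2) i

theorem product_conC_one_reducible_conC_two :
    Reducible (product (ConC 1) (ConC 1)) (ConC 2) := by
  refine reducible_iff.2 ⟨letterwise (fun n m => Encodable.encode [coordCode m (n % 2)])
    (fun n => 2 * (n / 2) + 1), letterwise stripCode (fun n => n.unpair.1), ?_, ?_, ?_⟩
  · refine computableFun_letterwise ?_ ?_ (fun n => by omega)
    · exact Primrec.encode.comp₂ (Primrec.list_cons.comp₂ (primrec_coordCode.comp₂ Primrec₂.right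
        (Primrec.nat_mod.comp₂ Primrec₂.left (Primrec₂.const 2))) (Primrec₂.const []))
    · exact Primrec.nat_double_succ.comp (Primrec.nat_div.comp Primrec.id (Primrec.const 2))
  · exact computableFun_letterwise primrec_stripCode (Primrec.fst.comp Primrec.unpair)
      (fun n => (Nat.unpair_left_le n).trans (by omega))
  · have key : ∀ p (x : TopologicalSpace.Closeds (Cube 1) × TopologicalSpace.Closeds (Cube 1)),
        IsName p x → IsName (fun n => stripCode n (p n.unpair.1)) (rectangle x.1 x.2) := by
      rintro p ⟨A, B⟩ ⟨a, b, rfl, ha, hb⟩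
      have ha' : (A : Set (Cube 1)) = _ := ha
      have hb' : (B : Set (Cube 1)) = _ := hb
      change (rectangle A B : Set (Cube 2)) = _
      ext x
      rw [Set.mem_compl_iff, mem_iUnion_ratBall_strip, not_or, SetLike.mem_coe, mem_rectangle,
        ← SetLike.mem_coe, ← SetLike.mem_coe, ha', hb', Set.mem_compl_iff, Set.mem_compl_iff]
    constructor
    · rintro p x hp ⟨⟨y, y'⟩, hy, hy'⟩
      have hc := isConnected_rectangle hy.1 hy'.1
      exact ⟨_, Part.mem_some _, _, key p x hp, hc.nonempty.some, hc, hc.nonempty.some_mem⟩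
    · rintro p x hp ⟨⟨y, y'⟩, hy, hy'⟩ s hs z hz w hw q hq
      rw [letterwise, Part.mem_some_iff] at hs
      subst hs
      rw [RepresentedSpace.unique hz (key p x hp)] at hw
      refine ⟨_, Part.mem_some _, (fun _ => w 0, fun _ => w 1), ⟨⟨hy.1, hw.2.1⟩, hy'.1, hw.2.2⟩,
        _, _, ?_, isName_coordinate hq 0, isName_coordinate hq 1⟩
      funext n
      rcases Nat.even_or_odd' n with ⟨i, rfl | rfl⟩
      · have e : 2 * i / 2 = i := by omega
        simp [e]
      · have e : (2 * i + 1) / 2 = i := by omega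
        have e' : (2 * i + 1) % 2 = 1 := by omega
        simp only [e, e', pair_odd]
        rfl

/-! ### Names that reveal information late -/

theorem ratBall_zero (n : ℕ) : ratBall n 0 = ∅ := by
  have : Nat.unpair 0 = (0, 0) := Nat.unpair_zero
  simp [ratBall, this, ratNum]

theorem conC_eq {n : ℕ} {A : TopologicalSpace.Closeds (Cube n)}
    (hA : IsConnected (A : Set (Cube n))) : ConC n A = A :=
  Set.ext fun _ => ⟨fun h => h.2, fun h => ⟨hA, h⟩⟩

theorem isConnected_of_conC_nonempty {n : ℕ} {A : TopologicalSpace.Closeds (Cube n)}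
    (h : (ConC n A).Nonempty) : IsConnected (A : Set (Cube n)) := h.some_mem.1

theorem conC_nonempty {n : ℕ} {A : TopologicalSpace.Closeds (Cube n)}
    (hA : IsConnected (A : Set (Cube n))) : (ConC n A).Nonempty := by
  rw [conC_eq hA]
  exact hA.nonempty

theorem isConnected_top (n : ℕ) :
    IsConnected ((⊤ : TopologicalSpace.Closeds (Cube n)) : Set (Cube n)) := by
  rw [TopologicalSpace.Closeds.coe_top]
  exact isConnected_univ

/-- The closed set with a single point. -/
def point {n : ℕ} (x : Cube n) : TopologicalSpace.Closeds (Cube n) := ⟨{x}, isClosed_singleton⟩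

theorem isConnected_point {n : ℕ} (x : Cube n) : IsConnected (point x : Set (Cube n)) :=
  isConnected_singleton

/-- Precede `p` by `m` codes of the empty ball. -/
def delay (m : ℕ) (p : Baire) : Baire := fun k => if k < m then 0 else p (k - m)

theorem delay_apply_of_lt {m k : ℕ} (p : Baire) (h : k < m) : delay m p k = 0 := if_pos h

theorem isName_delay {n : ℕ} {p : Baire} {A : TopologicalSpace.Closeds (Cube n)}
    (h : IsName p A) (m : ℕ) : IsName (delay m p) A := by
  refine Eq.trans (show (A : Set (Cube n)) = _ from h) (congrArg _ (Set.ext fun x => ?_))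
  simp only [Set.mem_iUnion]
  constructor
  · rintro ⟨i, hi⟩
    exact ⟨i + m, by simpa [delay] using hi⟩
  · rintro ⟨i, hi⟩
    unfold delay at hi
    split_ifs at hi with him
    · simp [ratBall_zero] at hi
    · exact ⟨_, hi⟩

theorem isName_zero (n : ℕ) : IsName (fun _ => 0) (⊤ : TopologicalSpace.Closeds (Cube n)) := by
  change ((⊤ : TopologicalSpace.Closeds (Cube n)) : Set (Cube n)) = _
  simp [ratBall_zero]

theorem cube_one_ext {x y : Cube 1} (h : (x 0 : ℝ) = y 0) : x = y := by
  funext i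
  rw [Subsingleton.elim i 0]
  exact Subtype.ext h

/-- A connected set of diameter at least `1 / M` meets the grid of mesh `1 / M`. -/
theorem exists_grid_mem {S : Set (Cube 1)} (hS : IsPreconnected S) {M : ℕ} {u v : Cube 1}
    (hu : u ∈ S) (hv : v ∈ S) (h : 1 ≤ dist u v * M) :
    ∃ l ≤ M, ∃ x ∈ S, (x 0 : ℝ) * M = (l : ℕ) := by
  wlog huv : (u 0 : ℝ) ≤ v 0 generalizing u v
  · exact this hv hu (by rwa [dist_comm]) (le_of_not_ge huv)
  have hord : ((fun x : Cube 1 => (x 0 : ℝ)) '' S).OrdConnected :=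
    (hS.image _ (by fun_prop)).ordConnected
  rw [dist_cube_one, Subtype.dist_eq, Real.dist_eq, abs_sub_comm,
    abs_of_nonneg (sub_nonneg.2 huv)] at h
  have hM : (0 : ℝ) < M := by
    rcases Nat.eq_zero_or_pos M with rfl | hM
    · norm_num at h
    · exact_mod_cast hM
  have hu0 : (0 : ℝ) ≤ u 0 := (u 0).2.1
  have hv1 : (v 0 : ℝ) ≤ 1 := (v 0).2.2
  have h1 := Nat.le_ceil ((u 0 : ℝ) * M)
  have h2 := Nat.ceil_lt_add_one (mul_nonneg hu0 hM.le)
  have h3 : (⌈(u 0 : ℝ) * M⌉₊ : ℝ) ≤ v 0 * M := by linarith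
  -- The first grid point not to the left of `u` is still at most `v`.
  have h4 : (⌈(u 0 : ℝ) * M⌉₊ : ℝ) / M ∈ (fun x : Cube 1 => (x 0 : ℝ)) '' S :=
    hord.out ⟨u, hu, rfl⟩ ⟨v, hv, rfl⟩ ⟨(le_div_iff₀ hM).2 h1, (div_le_iff₀ hM).2 h3⟩
  obtain ⟨x, hx, hxe⟩ := h4
  refine ⟨_, ?_, x, hx, (eq_div_iff hM.ne').1 hxe⟩
  have : (⌈(u 0 : ℝ) * M⌉₊ : ℝ) ≤ M := h3.trans (mul_le_of_le_one_left hM.le hv1)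
  exact_mod_cast this

theorem isConnected_solutions_conC {X Y : Type*} [RepresentedSpace X] [RepresentedSpace Y]
    {K H : Baire →. Baire} {f : MultiFun X Y} {n : ℕ} (h : IsReduction K H f (ConC n)) {p : Baire}
    {x : X} (hp : IsName p x) (hx : (f x).Nonempty) : IsConnected (solutions H (ConC n) p) := by
  obtain ⟨z, hz, he⟩ := h.exists_solutions_eq hp hx
  have := isConnected_of_conC_nonempty hz
  rwa [he, conC_eq this]

/-! ### The square does not reduce to the interval -/

section Square

variable {K H : Baire →. Baire}

/-- If `[0,1]²` is shrunk to a vertical segment late enough, then the solutions of the resulting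
instance do not fit into a small ball. -/
theorem exists_solutions_not_subset_ball (h : IsReduction K H (product (ConC 1) (ConC 1)) (ConC 1))
    (hK : ContinuousFun K) (hH : ContinuousFun H) :
    ∃ n, ∃ δ > 0, ∀ m ≥ n, ∀ p (A : TopologicalSpace.Closeds (Cube 1)), IsName p A →
      IsConnected (A : Set (Cube 1)) → ∀ w,
        ¬ solutions H (ConC 1) (pair (delay m p) fun _ => 0) ⊆ Metric.ball w δ := by
  obtain ⟨n, δ, hδ, hn⟩ := h.uniform_answer hK hH (closedGraph_conC 1)
    ((continuousRep_cube 1).prod (continuousRep_cube 1)) (openRep_cube 1)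
    (p := pair (fun _ => 0) fun _ => 0) (x := (⊤, ⊤)) ⟨_, _, rfl, isName_zero 1, isName_zero 1⟩
    ((conC_nonempty (isConnected_top 1)).prod (conC_nonempty (isConnected_top 1)))
    (ε := 1 / 4) (by norm_num)
  refine ⟨n, δ, hδ, fun m hm p A hp hA w hsub => ?_⟩
  obtain ⟨y₀, hy⟩ := hn w
  -- By upper semicontinuity the solutions stay in the ball if the second factor shrinks to a point
  -- `b` after stage `k`. All answers then have second coordinate near `y₀.2`, for `b = 0` and `b =
  -- 1` alike.
  obtain ⟨k, hk⟩ := h.solutions_subset hH (closedGraph_conC 1) (x := (A, ⊤))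
    ⟨_, _, rfl, isName_delay hp m, isName_zero 1⟩
    ((conC_nonempty hA).prod (conC_nonempty (isConnected_top 1))) Metric.isOpen_ball hsub
  have key : ∀ b : Cube 1, dist b y₀.2 ≤ 1 / 4 := by
    intro b
    obtain ⟨q, hq⟩ := RepresentedSpace.surj (point b)
    have hname : IsName (pair (delay m p) (delay (max k n) q)) (A, point b) :=
      ⟨_, _, rfl, isName_delay hp m, isName_delay hq _⟩
    have hne : (product (ConC 1) (ConC 1) (A, point b)).Nonempty :=
      (conC_nonempty hA).prod (conC_nonempty (isConnected_point b))
    obtain ⟨w', hw'⟩ := h.solutions_nonempty hname hne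
    have hball := hk _ (pair_congr (fun i _ => rfl)
      fun i hi => delay_apply_of_lt q (lt_max_of_lt_left hi)) hw'
    obtain ⟨y, ⟨-, hy2⟩, hd⟩ := hy _ _ hname hne (pair_congr
      (fun i hi => delay_apply_of_lt p (hi.trans_le hm))
      (fun i hi => delay_apply_of_lt q (lt_max_of_lt_right hi))) w' hw' hball
    obtain rfl : y.2 = b := hy2.2
    exact (le_max_right _ _).trans hd
  have h0 := key fun _ => 0
  have h1 := key fun _ => 1
  have h2 := dist_triangle_right (fun _ => 0 : Cube 1) (fun _ => 1) y₀.2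
  have h3 : dist (fun _ => 0 : Cube 1) (fun _ => 1) = 1 := by
    rw [dist_cube_one, Subtype.dist_eq, Real.dist_eq]
    simp
  linarith

theorem product_conC_one_not_reducible_conC_one :
    ¬ Reducible (product (ConC 1) (ConC 1)) (ConC 1) := by
  rw [reducible_iff]
  rintro ⟨K, H, hK, hH, h⟩
  replace hK := hK.continuousFun
  replace hH := hH.continuousFun
  obtain ⟨n, δ, hδ, hn⟩ := exists_solutions_not_subset_ball h hK hH
  obtain ⟨M, hM⟩ := exists_nat_gt δ⁻¹
  have hMδ : 1 ≤ δ * M := by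
    rw [← inv_mul_le_iff₀ hδ, mul_one]
    exact hM.le
  have hM1 : (0 : ℝ) < M + 1 := by positivity
  -- Two answers to a common solution differ by at most `2 * ε`, which is half the spacing `1 / (M +
  -- 1)` of the segments below.
  obtain ⟨n', η, hη, hn'⟩ := h.uniform_answer hK hH (closedGraph_conC 1)
    ((continuousRep_cube 1).prod (continuousRep_cube 1)) (openRep_cube 1)
    (p := pair (fun _ => 0) fun _ => 0) (x := (⊤, ⊤)) ⟨_, _, rfl, isName_zero 1, isName_zero 1⟩
    ((conC_nonempty (isConnected_top 1)).prod (conC_nonempty (isConnected_top 1)))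
    (ε := 1 / (4 * (M + 1))) (by positivity)
  let a : Fin (M + 2) → Cube 1 := fun i _ => ⟨(i : ℝ) / (M + 1),
    div_nonneg (Nat.cast_nonneg _) hM1.le, (div_le_one hM1).2 (by
      have : ((i : ℕ) : ℝ) ≤ ((M + 1 : ℕ) : ℝ) := Nat.cast_le.2 (Nat.lt_succ_iff.1 i.2)
      push_cast at this
      exact this)⟩
  have ha : ∀ i j, i ≠ j → 1 / (M + 1 : ℝ) ≤ dist (a i) (a j) := by
    intro i j hij
    rw [dist_cube_one, Subtype.dist_eq, Real.dist_eq]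
    change _ ≤ |(i : ℝ) / (M + 1) - (j : ℝ) / (M + 1)|
    rw [← sub_div, abs_div, abs_of_pos hM1]
    refine div_le_div_of_nonneg_right ?_ hM1.le
    have : (1 : ℤ) ≤ |((i : ℕ) : ℤ) - ((j : ℕ) : ℤ)| := by
      refine Int.one_le_abs (sub_ne_zero.2 fun he => hij (Fin.ext (by exact_mod_cast he)))
    exact_mod_cast this
  choose q hq using fun i => RepresentedSpace.surj (point (a i))
  let P : Fin (M + 2) → Baire := fun i => pair (delay (max n n') (q i)) fun _ => 0
  have hP : ∀ i, IsName (P i) (point (a i), (⊤ : TopologicalSpace.Closeds (Cube 1))) :=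
    fun i => ⟨_, _, rfl, isName_delay (hq i) _, isName_zero 1⟩
  have hne : ∀ i, (product (ConC 1) (ConC 1) (point (a i), ⊤)).Nonempty := fun i =>
    (conC_nonempty (isConnected_point _)).prod (conC_nonempty (isConnected_top 1))
  have hgrid : ∀ i, ∃ l : Fin (M + 1), ∃ x ∈ solutions H (ConC 1) (P i), (x 0 : ℝ) * M = l := by
    intro i
    obtain ⟨u, hu⟩ := h.solutions_nonempty (hP i) (hne i)
    obtain ⟨v, hv, hvu⟩ := Set.not_subset.1
      (hn (max n n') (le_max_left _ _) (q i) _ (hq i) (isConnected_point _) u)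
    rw [Metric.mem_ball, not_lt] at hvu
    obtain ⟨l, hl, x, hx, he⟩ := exists_grid_mem
      (isConnected_solutions_conC h (hP i) (hne i)).isPreconnected hv hu
      (hMδ.trans (mul_le_mul_of_nonneg_right hvu (Nat.cast_nonneg M)))
    exact ⟨⟨l, Nat.lt_succ_iff.2 hl⟩, x, hx, he⟩
  choose l x hx hl using hgrid
  -- There are `M + 2` segments but only `M + 1` grid points.
  obtain ⟨i, j, hij, hlij⟩ := Fintype.exists_ne_map_eq_of_card_lt l (by simp)
  have hMne : (M : ℝ) ≠ 0 := by
    rintro h0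
    rw [h0, mul_zero] at hMδ
    norm_num at hMδ
  have hxij : x i = x j := by
    refine cube_one_ext (mul_right_cancel₀ hMne ?_)
    rw [hl, hl, hlij]
  obtain ⟨y₀, hy⟩ := hn' (x i)
  have key : ∀ k, x i = x k → dist (a k) y₀.1 ≤ 1 / (4 * (M + 1)) := by
    intro k hk
    obtain ⟨y, ⟨hy1, -⟩, hd⟩ := hy (P k) _ (hP k) (hne k) (pair_congr
      (fun i hi => delay_apply_of_lt _ (lt_max_of_lt_right hi)) (fun i _ => rfl)) (x k) (hx k)
      (by rwa [hk, dist_self])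
    have hya : y.1 = a k := hy1.2
    rw [← hya]
    exact (le_max_left _ _).trans hd
  have h1 := ha i j hij
  have h2 := dist_triangle_right (a i) (a j) y₀.1
  have h3 := key i rfl
  have h4 := key j hxij
  have h5 : 1 / (4 * (M + 1 : ℝ)) = 1 / (M + 1) / 4 := by
    field_simp
  have h6 : 0 < 1 / (M + 1 : ℝ) := by positivity
  linarith

end Square

/-! ### Probes, crosses and the diagonal instance -/

theorem exists_ratBall_subset {n : ℕ} {U : Set (Cube n)} (hU : IsOpen U) {x : Cube n} (hx : x ∈ U) :
    ∃ m, x ∈ ratBall n m ∧ ratBall n m ⊆ U := by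
  obtain ⟨ε, hε, hball⟩ := Metric.isOpen_iff.1 hU x hx
  obtain ⟨k, hk⟩ := exists_ratPoint_dist_lt n x (half_pos hε)
  obtain ⟨q, hq1, hq2⟩ := exists_rat_btwn hk
  obtain ⟨r, hr⟩ := exists_ratNum q (by
    have : (0 : ℝ) ≤ q := dist_nonneg.trans hq1.le
    exact_mod_cast this)
  refine ⟨Nat.pair k r, ?_, fun y hy => hball ?_⟩
  · simpa only [ratBall, Nat.unpair_pair, hr, Metric.mem_ball] using hq1
  · simp only [ratBall, Nat.unpair_pair, hr, Metric.mem_ball] at hy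
    rw [Metric.mem_ball]
    have := dist_triangle y (ratPoint n k) x
    rw [dist_comm (ratPoint n k) x] at this
    linarith

/-- A countable family of closed sets such that every interval meets one of them in exactly one
point. -/
noncomputable def probe : ℕ → Set (Cube 1)
  | 0 => Set.univ
  | k + 1 => {ratPoint 1 k}

theorem isClosed_probe : ∀ k, IsClosed (probe k)
  | 0 => isClosed_univ
  | _ + 1 => isClosed_singleton

/-- A degenerate interval is isolated by the whole space, a nondegenerate one by a rational point
inside it. -/
theorem exists_probe_inter {S : Set (Cube 1)} (hS : IsConnected S) :
    ∃ k x, probe k ∩ S = {x} := by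
  rcases S.subsingleton_or_nontrivial with h | h
  · obtain ⟨x, hx⟩ := hS.nonempty
    exact ⟨0, x, by rw [probe, Set.univ_inter, h.eq_singleton_of_mem hx]⟩
  · have : ∃ u ∈ S, ∃ v ∈ S, (u 0 : ℝ) < v 0 := by
      obtain ⟨u, hu, v, hv, huv⟩ := h
      rcases lt_or_gt_of_ne fun he => huv (cube_one_ext he) with hlt | hlt
      · exact ⟨u, hu, v, hv, hlt⟩
      · exact ⟨v, hv, u, hu, hlt⟩
    obtain ⟨u, hu, v, hv, huv⟩ := this
    obtain ⟨q, hq1, hq2⟩ := exists_rat_btwn huv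
    have hq0 : (0 : ℝ) ≤ q := (u 0).2.1.trans hq1.le
    have hq1' : (q : ℝ) ≤ 1 := hq2.le.trans (v 0).2.2
    obtain ⟨k, hk⟩ := exists_ratPoint 1 (fun _ => q) fun _ => by exact_mod_cast hq0
    have hord : ((fun x : Cube 1 => (x 0 : ℝ)) '' S).OrdConnected :=
      (hS.isPreconnected.image _ (by fun_prop)).ordConnected
    obtain ⟨x, hx, hxq⟩ := hord.out ⟨u, hu, rfl⟩ ⟨v, hv, rfl⟩ ⟨hq1.le, hq2.le⟩
    have hxk : x = ratPoint 1 k := by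
      refine cube_one_ext ?_
      rw [hk 0, Set.projIcc_of_mem zero_le_one (show (q : ℝ) ∈ Set.Icc (0 : ℝ) 1 from ⟨hq0, hq1'⟩)]
      exact hxq
    refine ⟨k + 1, x, ?_⟩
    rw [probe, ← hxk, Set.inter_eq_left]
    simpa using hx

/-- The set of points of the square with at least one coordinate in `A`. -/
def cross (A : Set unitInterval) : Set (Cube 2) := {y | y 0 ∈ A ∨ y 1 ∈ A}

/-- Through each point of the cross runs a full horizontal or vertical segment inside it. This
segment meets a perpendicular one through `(a, a)`, which also lies in the cross. -/
theorem isConnected_cross {A : Set unitInterval} (hA : A.Nonempty) : IsConnected (cross A) := by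
  obtain ⟨a, ha⟩ := hA
  refine ⟨⟨fun _ => a, Or.inl ha⟩, isPreconnected_of_forall (fun _ => a) fun y hy => ?_⟩
  have hv : ∀ b : unitInterval, IsPreconnected (Set.range fun t => (![b, t] : Cube 2)) := fun b =>
    isPreconnected_range (continuous_pi fun i => by
      fin_cases i
      · exact continuous_const
      · exact continuous_id)
  have hh : ∀ b : unitInterval, IsPreconnected (Set.range fun t => (![t, b] : Cube 2)) := fun b =>
    isPreconnected_range (continuous_pi fun i => by
      fin_cases i
      · exact continuous_id
      · exact continuous_const)
  have haa : (fun _ => a : Cube 2) = ![a, a] := by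
    funext i
    fin_cases i <;> rfl
  have hyy : y = ![y 0, y 1] := by
    funext i
    fin_cases i <;> rfl
  rcases hy with hy | hy
  · refine ⟨(Set.range fun t => (![y 0, t] : Cube 2)) ∪ Set.range fun t => (![t, a] : Cube 2),
      ?_, Or.inr ⟨a, haa.symm⟩, Or.inl ⟨y 1, hyy.symm⟩,
      (hv _).union ![y 0, a] ⟨a, rfl⟩ ⟨y 0, rfl⟩ (hh a)⟩
    rintro _ (⟨t, rfl⟩ | ⟨t, rfl⟩)
    · exact Or.inl hy
    · exact Or.inr ha
  · refine ⟨(Set.range fun t => (![t, y 1] : Cube 2)) ∪ Set.range fun t => (![a, t] : Cube 2),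
      ?_, Or.inr ⟨a, haa.symm⟩, Or.inl ⟨y 0, hyy.symm⟩,
      (hh _).union ![a, y 1] ⟨a, rfl⟩ ⟨y 1, rfl⟩ (hv a)⟩
    rintro _ (⟨t, rfl⟩ | ⟨t, rfl⟩)
    · exact Or.inr hy
    · exact Or.inl ha

open MeasureTheory in
-- The two intervals for `k` have total length `2 ^ (-(k + 2))`. These lengths add up to `1/2`, so
-- the intervals cannot cover `[0,1]`; this is the reason for the exponent `k + 4`.
theorem exists_forall_pow_le_dist (d : ℕ → Cube 2) :
    ∃ t : unitInterval, ∀ k i, (1 / 2 : ℝ) ^ (k + 4) ≤ dist t (d k i) := by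
  by_contra! hcon
  have hsub : Set.Icc (0 : ℝ) 1 ⊆ ⋃ k, (Metric.ball (d k 0 : ℝ) ((1 / 2) ^ (k + 4)) ∪
      Metric.ball (d k 1 : ℝ) ((1 / 2) ^ (k + 4))) := by
    intro t ht
    obtain ⟨k, i, hki⟩ := hcon ⟨t, ht⟩
    refine Set.mem_iUnion.2 ⟨k, ?_⟩
    fin_cases i
    · exact Or.inl hki
    · exact Or.inr hki
  have hk : ∀ k, volume (Metric.ball (d k 0 : ℝ) ((1 / 2) ^ (k + 4)) ∪
      Metric.ball (d k 1 : ℝ) ((1 / 2) ^ (k + 4))) ≤ ENNReal.ofReal (1 / 4 * (1 / 2) ^ k) := by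
    intro k
    refine (measure_union_le _ _).trans ?_
    rw [Real.volume_ball, Real.volume_ball, ← ENNReal.ofReal_add (by positivity) (by positivity)]
    refine ENNReal.ofReal_le_ofReal (le_of_eq ?_)
    rw [pow_add]
    ring
  have hsum : Summable fun k : ℕ => (1 / 4 * (1 / 2) ^ k : ℝ) := summable_geometric_two.mul_left _
  have hle : (1 : ENNReal) ≤ ENNReal.ofReal (1 / 2) := by
    calc (1 : ENNReal) = volume (Set.Icc (0 : ℝ) 1) := by simp
      _ ≤ _ := measure_mono hsub
      _ ≤ _ := measure_iUnion_le _
      _ ≤ ∑' k : ℕ, ENNReal.ofReal (1 / 4 * (1 / 2) ^ k) := ENNReal.tsum_le_tsum hk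
      _ = ENNReal.ofReal (∑' k : ℕ, 1 / 4 * (1 / 2) ^ k) :=
        (ENNReal.ofReal_tsum_of_nonneg (fun _ => by positivity) hsum).symm
      _ = ENNReal.ofReal (1 / 2) := by
        rw [tsum_mul_left, tsum_geometric_two]
        norm_num
  rw [ENNReal.one_le_ofReal] at hle
  norm_num at hle

theorem prefixOf_isPrefix (p : Baire) {m n : ℕ} (h : m ≤ n) : prefixOf p m <+: prefixOf p n := by
  obtain ⟨d, rfl⟩ := Nat.exists_eq_add_of_le h
  simp [prefixOf, List.range_add]

theorem eq_prefixOf_of_isPrefix {p : Baire} {n : ℕ} {v : List ℕ} (h : v <+: prefixOf p n) :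
    v.length ≤ n ∧ v = prefixOf p v.length := by
  have hl : v.length ≤ n := by simpa [length_prefixOf] using h.length_le
  refine ⟨hl, (List.prefix_of_prefix_length_le h (prefixOf_isPrefix p hl) ?_).eq_of_length ?_⟩ <;>
    simp [length_prefixOf]

/-- A sequence can be defined from a rule that prescribes the next term after each word. -/
theorem exists_forall_eq_prefixOf (next : List ℕ → ℕ) : ∃ p : Baire, ∀ n, p n = next (prefixOf p n) := by
  let word : ℕ → List ℕ := fun n => Nat.rec [] (fun _ u => u ++ [next u]) n
  have hw : ∀ n, prefixOf (fun n => next (word n)) n = word n := by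
    intro n
    induction n with
    | zero => rfl
    | succ n ih => rw [prefixOf_succ, ih]
  exact ⟨fun n => next (word n), fun n => by rw [hw]⟩

section Diagonal

variable (c : ℕ → List ℕ → Option (Cube 2))

/-- `v` is the shortest among its prefixes for which the rule `c k` yields a point. -/
def FirstHit (k : ℕ) (v : List ℕ) (y : Cube 2) : Prop :=
  c k v = some y ∧ ∀ v', v' <+: v → v' ≠ v → c k v' = none

/-- The union of the intervals that have been removed when the word `u` has been written. -/
def removed (u : List ℕ) : Set unitInterval :=
  {t | ∃ k v y, v <+: u ∧ FirstHit c k v y ∧ ∃ i, dist t (y i) < (1 / 2 : ℝ) ^ (k + 4)}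

theorem removed_mono {u v : List ℕ} (h : u <+: v) : removed c u ⊆ removed c v := by
  rintro t ⟨k, w, y, hw, hy⟩
  exact ⟨k, w, y, hw.trans h, hy⟩

theorem isOpen_removed (u : List ℕ) : IsOpen (removed c u) := by
  have : removed c u = ⋃ (k) (v) (y) (_ : v <+: u ∧ FirstHit c k v y) (i),
      Metric.ball (y i) ((1 / 2 : ℝ) ^ (k + 4)) := by
    ext t
    simp [removed]
  rw [this]
  exact isOpen_iUnion fun _ => isOpen_iUnion fun _ => isOpen_iUnion fun _ => isOpen_iUnion fun _ =>
    isOpen_iUnion fun _ => Metric.isOpen_ball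

variable {c}

/-- Prefixes of one sequence are comparable, so each `k` causes at most one removal along it. This
keeps the total removed length bounded. -/
theorem FirstHit.unique {k : ℕ} {p : Baire} {m n : ℕ} {v w : List ℕ} {y z : Cube 2}
    (hv : FirstHit c k v y) (hw : FirstHit c k w z) (hvp : v <+: prefixOf p m)
    (hwp : w <+: prefixOf p n) : y = z := by
  have hvw : v = w := by
    by_contra hne
    rcases List.prefix_or_prefix_of_prefix (hvp.trans (prefixOf_isPrefix p (le_max_left m n)))
      (hwp.trans (prefixOf_isPrefix p (le_max_right m n))) with h | h
    · have := hw.2 v h hne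
      rw [hv.1] at this
      cases this
    · have := hv.2 w h (Ne.symm hne)
      rw [hw.1] at this
      cases this
  subst hvw
  exact Option.some.inj (hv.1.symm.trans hw.1)

theorem exists_firstHit {k : ℕ} {p : Baire} {n : ℕ} (h : c k (prefixOf p n) ≠ none) :
    ∃ m y, FirstHit c k (prefixOf p m) y := by
  classical
  have hex : ∃ n, c k (prefixOf p n) ≠ none := ⟨n, h⟩
  obtain ⟨y, hy⟩ := Option.ne_none_iff_exists'.1 (Nat.find_spec hex)
  refine ⟨Nat.find hex, y, hy, fun v hv hne => ?_⟩
  obtain ⟨hl, he⟩ := eq_prefixOf_of_isPrefix hv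
  rw [he]
  by_contra hc
  have := Nat.find_min' hex hc
  exact hne (he.trans (by rw [le_antisymm hl this]))

variable (c)

theorem exists_forall_notMem_removed (p : Baire) : ∃ t, ∀ n, t ∉ removed c (prefixOf p n) := by
  classical
  -- Indices that never act receive a dummy centre, which only enlarges the set to be avoided.
  let d : ℕ → Cube 2 := fun k => if h : ∃ y, ∃ n v, v <+: prefixOf p n ∧ FirstHit c k v y then
    h.choose else fun _ => 0
  obtain ⟨t, ht⟩ := exists_forall_pow_le_dist d
  refine ⟨t, fun n => ?_⟩
  rintro ⟨k, v, y, hv, hy, i, hi⟩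
  have hex : ∃ y, ∃ n v, v <+: prefixOf p n ∧ FirstHit c k v y := ⟨y, n, v, hv, hy⟩
  have hd : d k = y := by
    obtain ⟨n', v', hv', hy'⟩ := hex.choose_spec
    simp only [d, dif_pos hex]
    exact hy'.unique hy hv' hv
  have := ht k i
  rw [hd] at this
  exact this.not_gt hi

end Diagonal

/-- Suppose that it depends on `k` and a word whether a point of the square is threatening. There
is an instance of connected choice in the square such that, for every `k`, if some prefix of its
name makes a point threatening, then all solutions keep distance from such a point. -/
theorem exists_avoiding_instance (T : ℕ → List ℕ → Cube 2 → Prop) :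
    ∃ (p : Baire) (S : TopologicalSpace.Closeds (Cube 2)), IsName p S ∧
      IsConnected (S : Set (Cube 2)) ∧ ∀ k, (∃ n y, T k (prefixOf p n) y) →
        ∃ n y, T k (prefixOf p n) y ∧ ∀ x ∈ S, (1 / 2 : ℝ) ^ (k + 4) ≤ dist x y := by
  classical
  let c : ℕ → List ℕ → Option (Cube 2) := fun k u => if h : ∃ y, T k u y then some h.choose else none
  have hc : ∀ {k u y}, c k u = some y → T k u y := by
    intro k u y h
    by_cases hex : ∃ y, T k u y
    · simp only [c, dif_pos hex, Option.some.injEq] at h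
      exact h ▸ hex.choose_spec
    · simp [c, dif_neg hex] at h
  let Q : List ℕ → Set (Cube 2) := fun u => {y | y 0 ∈ removed c u ∧ y 1 ∈ removed c u}
  have hQ : ∀ u, IsOpen (Q u) := fun u =>
    ((isOpen_removed c u).preimage (by fun_prop : Continuous fun y : Cube 2 => y 0)).inter
      ((isOpen_removed c u).preimage (by fun_prop : Continuous fun y : Cube 2 => y 1))
  -- Stage `Nat.pair b m` tests ball `b`, and `0` codes the empty ball. Each ball is tested
  -- infinitely often and the sets `Q` grow along `p`, so a ball that is eventually contained in
  -- them gets listed. The name thus reacts to its own prefixes.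
  obtain ⟨p, hp⟩ := exists_forall_eq_prefixOf fun u =>
    if ratBall 2 u.length.unpair.1 ⊆ Q u then u.length.unpair.1 else 0
  let R : Set unitInterval := ⋃ n, removed c (prefixOf p n)
  have hname : cross Rᶜ = (⋃ n, ratBall 2 (p n))ᶜ := by
    rw [← compl_inj_iff, compl_compl]
    ext y
    simp only [cross, Set.mem_compl_iff, Set.mem_ofPred_eq, not_or, not_not, Set.mem_iUnion, R]
    constructor
    · rintro ⟨⟨m, hm⟩, ⟨n, hn⟩⟩
      have hy : y ∈ Q (prefixOf p (max m n)) :=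
        ⟨removed_mono c (prefixOf_isPrefix p (le_max_left m n)) hm,
          removed_mono c (prefixOf_isPrefix p (le_max_right m n)) hn⟩
      obtain ⟨b, hb, hbQ⟩ := exists_ratBall_subset (hQ _) hy
      refine ⟨Nat.pair b (max m n), ?_⟩
      have hpre := prefixOf_isPrefix p (Nat.right_le_pair b (max m n))
      have hsub : ratBall 2 b ⊆ Q (prefixOf p (Nat.pair b (max m n))) := fun x hx =>
        ⟨removed_mono c hpre (hbQ hx).1, removed_mono c hpre (hbQ hx).2⟩
      rw [hp, length_prefixOf, Nat.unpair_pair, if_pos hsub]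
      exact hb
    · rintro ⟨n, hn⟩
      rw [hp] at hn
      split_ifs at hn with hsub
      · exact ⟨⟨n, (hsub hn).1⟩, ⟨n, (hsub hn).2⟩⟩
      · simp [ratBall_zero] at hn
  have hclosed : IsClosed (cross Rᶜ) := by
    rw [hname]
    exact (isOpen_iUnion fun n => Metric.isOpen_ball).isClosed_compl
  refine ⟨p, ⟨cross Rᶜ, hclosed⟩, hname, isConnected_cross ?_, fun k => ?_⟩
  · obtain ⟨t, ht⟩ := exists_forall_notMem_removed c p
    exact ⟨t, by simpa [R] using ht⟩
  · rintro ⟨n, y, hy⟩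
    obtain ⟨m, z, hz⟩ := exists_firstHit (c := c) (k := k) (p := p) (n := n) (by
      simp only [c, dif_pos (show ∃ y, T k (prefixOf p n) y from ⟨y, hy⟩)]
      exact Option.some_ne_none _)
    refine ⟨m, z, hc hz.1, fun x hx => ?_⟩
    by_contra! hlt
    have hx' : ∀ i, x i ∈ R := fun i => Set.mem_iUnion.2
      ⟨m, k, _, z, List.prefix_rfl, hz, i, (dist_le_pi_dist x z i).trans_lt hlt⟩
    rcases hx with h | h
    · exact h (hx' 0)
    · exact h (hx' 1)

/-! ### Dimension two does not reduce to the product -/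

theorem conC_two_not_reducible_product_conC_one :
    ¬ Reducible (ConC 2) (product (ConC 1) (ConC 1)) := by
  rw [reducible_iff]
  rintro ⟨K, H, hK, hH, h⟩
  replace hK := hK.continuousFun
  replace hH := hH.continuousFun
  have hg := (closedGraph_conC 1).product (closedGraph_conC 1)
  let C : ℕ → Set (Cube 1 × Cube 1) := fun k => probe k.unpair.1 ×ˢ probe k.unpair.2
  -- Here `y₀` threatens after `u` if every solution in probe `k`, for any instance extending `u`,
  -- admits an answer near `y₀`. The radius `2 ^ (-(k + 5))` is smaller than the distance `2 ^ (-(k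
  -- + 4))` that `S` will keep.
  obtain ⟨p, S, hp, hS, havoid⟩ := exists_avoiding_instance fun k u y₀ =>
    ∀ p' x', IsName p' x' → (ConC 2 x').Nonempty → prefixOf p' u.length = u →
      ∀ w ∈ solutions H (product (ConC 1) (ConC 1)) p', w ∈ C k →
        ∃ y ∈ ConC 2 x', dist y y₀ ≤ (1 / 2 : ℝ) ^ (k + 5)
  have hne := conC_nonempty hS
  obtain ⟨k, w, hkw⟩ : ∃ k w, C k ∩ solutions H (product (ConC 1) (ConC 1)) p = {w} := by
    obtain ⟨⟨A, B⟩, hAB, he⟩ := h.exists_solutions_eq hp hne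
    obtain ⟨hA, hB⟩ := Set.prod_nonempty_iff.1 hAB
    replace hA := isConnected_of_conC_nonempty hA
    replace hB := isConnected_of_conC_nonempty hB
    obtain ⟨i, x, hx⟩ := exists_probe_inter hA
    obtain ⟨j, y, hy⟩ := exists_probe_inter hB
    refine ⟨Nat.pair i j, (x, y), ?_⟩
    simp only [he, product, conC_eq hA, conC_eq hB, C, Nat.unpair_pair]
    rw [Set.prod_inter_prod, hx, hy, Set.singleton_prod_singleton]
  have hw : w ∈ C k ∩ solutions H (product (ConC 1) (ConC 1)) p := hkw ▸ Set.mem_singleton w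
  obtain ⟨y₀, n, η, hη, hn⟩ := h.local_answer hK hH hg (continuousRep_cube 2)
    ((openRep_cube 1).prod (openRep_cube 1)) hp hne w
    (show (0 : ℝ) < (1 / 2) ^ (k + 5) by positivity)
  -- Since probe `k` isolates `w`, upper semicontinuity forces the solutions in `C k` of nearby
  -- instances to be close to `w`. Hence some prefix of `p` makes `y₀` threatening.
  obtain ⟨m, hm⟩ := h.solutions_subset hH hg hp hne (U := (C k)ᶜ ∪ Metric.ball w η)
    (((isClosed_probe _).prod (isClosed_probe _)).isOpen_compl.union Metric.isOpen_ball) (by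
      intro v hv
      by_cases hvC : v ∈ C k
      · right
        have : v ∈ ({w} : Set (Cube 1 × Cube 1)) := hkw ▸ ⟨hvC, hv⟩
        rw [Set.mem_singleton_iff.1 this]
        exact Metric.mem_ball_self hη
      · exact Or.inl hvC)
  obtain ⟨l, z, hz, hfar⟩ := havoid k ⟨max m n, y₀, by
    intro p' x' hp' hx' hpre v hv hvC
    rw [length_prefixOf] at hpre
    have hpp' := prefixOf_eq_iff.1 hpre
    refine hn p' x' hp' hx' (fun i hi => hpp' i (lt_max_of_lt_right hi)) v hv ?_
    exact (hm p' (fun i hi => hpp' i (lt_max_of_lt_left hi)) hv).resolve_left (not_not.2 hvC)⟩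
  -- The threat at `z` applies to `p` itself with solution `w`: some point of `S` is closer to `z`
  -- than `S` permits.
  obtain ⟨y, hy, hyz⟩ := hz p S hp hne (by rw [length_prefixOf]) w hw.2 hw.1
  have h1 := hfar y hy.2
  have h2 : (1 / 2 : ℝ) ^ (k + 5) < (1 / 2) ^ (k + 4) :=
    pow_lt_pow_right_of_lt_one₀ (by norm_num) (by norm_num) (Nat.lt_succ_self _)
  linarith

end Weihrauch

theorem theorem7p3 :
    Weihrauch.StrictlyReducible (Weihrauch.ConC 1)
        (Weihrauch.product (Weihrauch.ConC 1) (Weihrauch.ConC 1)) ∧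
      Weihrauch.StrictlyReducible (Weihrauch.product (Weihrauch.ConC 1) (Weihrauch.ConC 1))
        (Weihrauch.ConC 2) ∧
      ¬ Weihrauch.Idempotent (Weihrauch.ConC 1) :=
  ⟨⟨Weihrauch.reducible_product_self _, Weihrauch.product_conC_one_not_reducible_conC_one⟩,
    ⟨Weihrauch.product_conC_one_reducible_conC_two,
      Weihrauch.conC_two_not_reducible_product_conC_one⟩,
    fun h => Weihrauch.product_conC_one_not_reducible_conC_one h.2⟩
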